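/- For real numbers $p,r$ let $A_0(p,r)=1$ and $A_k(p,r)=\frac{r}{k!}\prod_{i=1}^{k-1}(kp+r-i)$ for $k\ge 1$ (so that $A_k(p,r)=\frac{r}{kp+r}\binom{kp+r}{k}$ whenever $kp+r\neq 0$). A Borel probability measure $\mu$ on $\mathbb{R}$ is called the Fuss--Catalan distribution $\mu(p,r)$ if all its moments are finite and $\int_{\mathbb{R}}x^k\,\mu(\mathrm{d}x)=A_k(p,r)$ for every integer $k\ge 0$. A measure $\mu$ on $\mathbb{R}$ is called unimodal if there are $a\in\mathbb{R}$, $c\ge 0$ and a function $f\ge 0$ on $\mathbb{R}$ which is non-decreasing on $(-\infty,a)$ and non-increasing on $(a,\infty)$ such that $\mu(\mathrm{d}x)=c\,\delta_a+f(x)\,\mathrm{d}x$. **Proposition.** For every real number $p\ge 1$ there is exactly one Fuss--Catalan distribution $\mu(p,p)$, and it is unimodal. -/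

import Mathlib

open MeasureTheory

/-- The two-parameter Fuss-Catalan (Raney) numbers: `A_0(p,r) = 1` and
`A_k(p,r) = (r / k!) * ∏_{i=1}^{k-1} (k p + r - i)` for `k ≥ 1`. When `k p + r ≠ 0` this is
`r / (k p + r)` times the generalized binomial coefficient of `k p + r` over `k`. -/
noncomputable def fussCatalanNumber (p r : ℝ) : ℕ → ℝ
  | 0 => 1
  | k + 1 => r / (Nat.factorial (k + 1) : ℝ) *
      ∏ i ∈ Finset.Icc 1 k, (((k + 1 : ℕ) : ℝ) * p + r - (i : ℝ))

/-- `μ` is a Fuss-Catalan distribution `μ(p,r)`: a Borel probability measure on the real line all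
of whose moments are finite, the `k`-th one being `A_k(p,r)` for every `k ≥ 0`. -/
structure IsFussCatalan (p r : ℝ) (μ : Measure ℝ) : Prop where
  isProbabilityMeasure : IsProbabilityMeasure μ
  integrable_pow : ∀ k : ℕ, Integrable (fun x : ℝ => x ^ k) μ
  integral_pow : ∀ k : ℕ, ∫ x : ℝ, x ^ k ∂μ = fussCatalanNumber p r k

/-- `μ` is unimodal with mode `a`: `μ(dx) = c δ_a + f(x) dx` with `c ≥ 0` and a (non-negative)
function `f` that is non-decreasing on `(-∞, a)` and non-increasing on `(a, ∞)`. -/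
def IsUnimodalWithMode (μ : Measure ℝ) (a : ℝ) : Prop :=
  ∃ (c : NNReal) (f : ℝ → ℝ), (∀ x, 0 ≤ f x) ∧
    MonotoneOn f (Set.Iio a) ∧ AntitoneOn f (Set.Ioi a) ∧
    μ = c • Measure.dirac a + volume.withDensity (fun x => ENNReal.ofReal (f x))

/-- `μ` is unimodal if it is unimodal with some mode. -/
def IsUnimodal (μ : Measure ℝ) : Prop :=
  ∃ a : ℝ, IsUnimodalWithMode μ a

/-! For `p = 1` all moments are `1` and the measure is `δ_1`. For `p > 1`, `A_k(p,p)` is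
`binom((k+1)p, k) / (k+1)`, and the binomial is the residue at `0` of `(1+z)^((k+1)p) / z^(k+1)`.
Take as contour the curve on which `ρ = (1+z)^p / z` is real and positive. In the upper half-plane
it joins `1/(p-1)` to `-1`, and along it the integrand is `ρ^(k+1)`. The imaginary part of the
contour integral is then the integral of `ρ^(k+1)` against `d(Im z)`. Integrating by parts turns it
into `(k+1)` times the `k`-th moment of `Im z` regarded as a function of `ρ`. So `Im z / π`, as a
function of `x = ρ`, is the density sought (`curve_moment`, `fussCatalanDensity_moment`).

The residue is computed on the upper half only: a primitive there has an imaginary part whose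
boundary values at the two ends of the curve differ by `π` times the binomial
(`exists_primitive_one_add_cpow_div_pow`).

Parametrized by `φ = arg(1+z)`, `ρ` is strictly decreasing (`strictAntiOn_curveValue`) and `Im z`
rises and then falls (`exists_curveHeight_mode`), which gives unimodality. The support is bounded,
so the moments grow at most geometrically and determine the measure through its characteristic
function (`measure_ext_of_moments`). -/

open Filter Topology Set

/-! ### Determinacy of the moment problem -/

/-- The characteristic function of a measure on the line whose even moments grow at most
geometrically is the sum of its moment series. -/
lemma hasSum_charFun_of_even_moment_le {μ : Measure ℝ} [IsProbabilityMeasure μ] {M : ℝ}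
    (hint : ∀ k : ℕ, Integrable (fun x : ℝ => x ^ k) μ)
    (hM : ∀ k : ℕ, ∫ x : ℝ, x ^ (2 * k) ∂μ ≤ M ^ (2 * k)) (t : ℝ) :
    HasSum (fun k : ℕ => (t * Complex.I) ^ k / (k.factorial : ℂ) * ((∫ x : ℝ, x ^ k ∂μ : ℝ) : ℂ))
      (charFun μ t) := by
  have habs : ∀ k : ℕ, Integrable (fun x : ℝ => |x| ^ k) μ := fun k => by
    simpa [abs_pow] using (hint k).abs
  -- Even moments control all absolute moments through `|x|^k ≤ 1 + x^(2k)`; this makes the termwise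
  -- integration of the exponential series legitimate.
  have hbound : ∀ k : ℕ, ∫ x : ℝ, |x| ^ k ∂μ ≤ 1 + (M ^ 2) ^ k := by
    intro k
    calc ∫ x : ℝ, |x| ^ k ∂μ ≤ ∫ x : ℝ, (1 + x ^ (2 * k)) ∂μ := by
          refine integral_mono (habs k) ((integrable_const _).add (hint _)) fun x => ?_
          have h : x ^ (2 * k) = (|x| ^ k) ^ 2 := by rw [← pow_mul, mul_comm k, pow_mul, pow_mul,
            sq_abs]
          simp only [h]
          nlinarith [sq_nonneg (|x| ^ k - 1), sq_nonneg (|x| ^ k)]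
      _ = 1 + ∫ x : ℝ, x ^ (2 * k) ∂μ := by
          rw [integral_add (integrable_const _) (hint _)]; simp
      _ ≤ 1 + (M ^ 2) ^ k := by rw [← pow_mul]; linarith [hM k]
  have hI : ∀ k : ℕ, Integrable
      (fun x : ℝ => (t * Complex.I) ^ k / (k.factorial : ℂ) * ((x ^ k : ℝ) : ℂ)) μ :=
    fun k => ((hint k).ofReal).const_mul _
  have hS : Summable fun k : ℕ =>
      ∫ x : ℝ, ‖(t * Complex.I) ^ k / (k.factorial : ℂ) * ((x ^ k : ℝ) : ℂ)‖ ∂μ := by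
    have h1 : Summable fun k : ℕ => |t| ^ k / k.factorial + (|t| * M ^ 2) ^ k / k.factorial :=
      (Real.summable_pow_div_factorial _).add (Real.summable_pow_div_factorial _)
    refine h1.of_nonneg_of_le (fun k => integral_nonneg fun x => norm_nonneg _) fun k => ?_
    have h2 : ∀ x : ℝ, ‖(t * Complex.I) ^ k / (k.factorial : ℂ) * ((x ^ k : ℝ) : ℂ)‖
        = |t| ^ k / k.factorial * |x| ^ k := by
      intro x
      simp
    simp_rw [h2]
    rw [integral_const_mul]
    calc |t| ^ k / k.factorial * ∫ x : ℝ, |x| ^ k ∂μ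
        ≤ |t| ^ k / k.factorial * (1 + (M ^ 2) ^ k) :=
          mul_le_mul_of_nonneg_left (hbound k) (by positivity)
      _ = _ := by rw [mul_pow]; ring
  have := hasSum_integral_of_summable_integral_norm hI hS
  rw [charFun_apply_real]
  have hexp : ∀ x : ℝ, Complex.exp (t * x * Complex.I)
      = ∑' k : ℕ, (t * Complex.I) ^ k / (k.factorial : ℂ) * ((x ^ k : ℝ) : ℂ) := by
    intro x
    rw [Complex.exp_eq_exp_ℂ, NormedSpace.exp_eq_tsum_div]
    refine tsum_congr fun k => ?_
    push_cast
    rw [mul_right_comm, mul_pow]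
    ring
  simp_rw [hexp]
  simpa only [integral_const_mul, integral_complex_ofReal] using this

/-- A moment problem with geometrically bounded moments is determinate. -/
lemma measure_ext_of_moments {μ ν : Measure ℝ} [IsProbabilityMeasure μ] [IsProbabilityMeasure ν]
    {M : ℝ} (hμ : ∀ k : ℕ, Integrable (fun x : ℝ => x ^ k) μ)
    (hν : ∀ k : ℕ, Integrable (fun x : ℝ => x ^ k) ν)
    (heq : ∀ k : ℕ, ∫ x : ℝ, x ^ k ∂μ = ∫ x : ℝ, x ^ k ∂ν)
    (hM : ∀ k : ℕ, ∫ x : ℝ, x ^ (2 * k) ∂μ ≤ M ^ (2 * k)) : μ = ν := by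
  refine Measure.ext_of_charFun (funext fun t => ?_)
  have h1 := hasSum_charFun_of_even_moment_le hμ hM t
  have h2 := hasSum_charFun_of_even_moment_le hν (fun k => heq (2 * k) ▸ hM k) t
  simp_rw [heq] at h1
  exact h1.unique h2

/-! ### Primitives on the upper half-plane and their boundary values -/

/-- A function that is complex differentiable on the upper half-plane has a primitive there. -/
lemma exists_primitive_upperHalfPlane {H : ℂ → ℂ}
    (hH : ∀ z : ℂ, 0 < z.im → DifferentiableAt ℂ H z) :
    ∃ Q : ℂ → ℂ, ∀ z : ℂ, 0 < z.im → HasDerivAt Q (H z) z := by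
  have hconv : Convex ℝ {z : ℂ | 0 < z.im} := convex_halfSpace_im_gt 0
  have hopen : IsOpen {z : ℂ | 0 < z.im} := isOpen_lt continuous_const Complex.continuous_im
  let L : ℂ →L[ℂ] ℂ →L[ℂ] ℂ := ContinuousLinearMap.mul ℂ ℂ
  -- The form `H dz` is closed: its derivative is `(x, y) ↦ H' x y`, symmetric because
  -- multiplication commutes. The Poincaré lemma on a convex open set then applies.
  have hω : ∀ z : ℂ, 0 < z.im → HasFDerivAt (fun z => L (H z))
      ((L.comp (ContinuousLinearMap.toSpanSingleton ℂ (deriv H z))).restrictScalars ℝ) z := by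
    intro z hz
    exact (L.hasFDerivAt.comp z (hH z hz).hasDerivAt.hasFDerivAt).restrictScalars ℝ
  obtain ⟨Q, hQ⟩ := hconv.exists_forall_hasFDerivAt_of_fderiv_symmetric (𝕜 := ℂ) hopen
    (ω := fun z => L (H z))
    (fun z hz => (hω z hz).differentiableAt.differentiableWithinAt)
    (fun z hz x y => by
      rw [(hω z hz).fderiv]
      simp [L]
      ring)
  refine ⟨Q, fun z hz => ?_⟩
  have := (hQ z hz).hasDerivAt
  simpa [L] using this

/-- Apart from `-1`, the closed quarter-plane is carried by `1 + z` into the slit plane. At `-1` the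
base vanishes and continuity comes from the positive exponent. -/
lemma continuousAt_one_add_cpow {β : ℝ} (hβ : 0 < β) {z : ℂ} (hz : -1 ≤ z.re) (hz0 : 0 ≤ z.im) :
    ContinuousAt (fun z : ℂ => (1 + z) ^ (β : ℂ)) z := by
  by_cases h : z = -1
  · subst h
    have h1 : ContinuousAt (fun x : ℂ × ℂ => x.1 ^ x.2) ((fun z : ℂ => (1 + z, (β : ℂ))) (-1)) := by
      simpa using Complex.continuousAt_cpow_zero_of_re_pos (z := (β : ℂ)) (by simpa using hβ)
    exact ContinuousAt.comp (f := fun z : ℂ => (1 + z, (β : ℂ))) h1 (by fun_prop)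
  · have h1 : 1 + z ∈ Complex.slitPlane := by
      rw [Complex.mem_slitPlane_iff]
      by_contra! h2
      obtain ⟨h2, h3⟩ := h2
      simp at h2 h3
      exact h (Complex.ext (by simp; linarith) (by simpa using h3))
    exact ContinuousAt.cpow (by fun_prop) continuousAt_const h1

lemma differentiableAt_one_add_cpow (β : ℝ) {z : ℂ} (hz : 1 + z ∈ Complex.slitPlane) :
    DifferentiableAt ℂ (fun z : ℂ => (1 + z) ^ (β : ℂ)) z :=
  (((hasDerivAt_id z).const_add 1).cpow_const hz).differentiableAt

lemma one_add_cpow_ofReal_im {β t : ℝ} (ht : -1 ≤ t) : ((1 + (t : ℂ)) ^ (β : ℂ)).im = 0 := by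
  have : (1 + (t : ℂ)) ^ (β : ℂ) = (((1 + t) ^ β : ℝ) : ℂ) := by
    rw [Complex.ofReal_cpow (by linarith)]
    push_cast; rfl
  rw [this, Complex.ofReal_im]

/-- The primitive on the upper half-plane of the difference quotient of `(1 + z) ^ β` at `0` has an
imaginary part with the same boundary values at `-1` and at a positive real number. -/
lemma exists_primitive_dslope {β x : ℝ} (hβ : 0 < β) (hx : 0 < x) :
    ∃ (Q : ℂ → ℂ) (c : ℝ), (∀ z : ℂ, 0 < z.im →
        HasDerivAt Q (((1 + z) ^ (β : ℂ) - 1) / z) z) ∧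
      Tendsto (fun z => (Q z).im) (𝓝[{z : ℂ | 0 < z.im}] x) (𝓝 c) ∧
      Tendsto (fun z => (Q z).im) (𝓝[{z : ℂ | 0 < z.im}] (-1)) (𝓝 c) := by
  set h : ℂ → ℂ := fun z : ℂ => (1 + z) ^ (β : ℂ) with hh
  -- `dslope` fills in the removable singularity at `0`, so `H` is continuous on the whole real
  -- segment from `-1` to `x`.
  set H : ℂ → ℂ := dslope h 0 with hHdef
  have hne : ∀ z : ℂ, z ≠ 0 → H z = ((1 + z) ^ (β : ℂ) - 1) / z := by
    intro z hz
    rw [hHdef, dslope_of_ne _ hz, slope_def_field]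
    simp [hh]
  have hd0 : DifferentiableAt ℂ h 0 := differentiableAt_one_add_cpow β (by simp)
  have hdiff : ∀ z : ℂ, 0 < z.im → DifferentiableAt ℂ H z := by
    intro z hz
    have hz0 : z ≠ 0 := by rintro rfl; simp at hz
    rw [hHdef, differentiableAt_dslope_of_ne hz0]
    exact differentiableAt_one_add_cpow β
      (Complex.mem_slitPlane_iff.2 (Or.inr (by simpa using hz.ne')))
  obtain ⟨Q, hQ⟩ := exists_primitive_upperHalfPlane hdiff
  have hcont : ∀ z : ℂ, -1 ≤ z.re → 0 ≤ z.im → ContinuousAt H z := by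
    intro z hz hz'
    by_cases hz0 : z = 0
    · subst hz0
      exact continuousAt_dslope_same.2 hd0
    · exact (continuousAt_dslope_of_ne hz0).2 (continuousAt_one_add_cpow hβ hz hz')
  have him : ∀ t : ℝ, -1 ≤ t → (H t).im = 0 := by
    intro t ht
    by_cases ht0 : t = 0
    · subst ht0
      have h1 : HasDerivAt h ((β : ℂ) * (1 + 0) ^ ((β : ℂ) - 1) * 1) 0 :=
        ((hasDerivAt_id (0 : ℂ)).const_add 1).cpow_const (by simp)
      simp [hHdef, dslope_same, h1.deriv]
    · rw [hne _ (by simpa using ht0), Complex.div_ofReal_im, Complex.sub_im,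
        one_add_cpow_ofReal_im ht]
      simp
  -- a Lipschitz bound on a half-disc
  set R : ℝ := x + 3 with hR
  obtain ⟨C, hC⟩ : ∃ C : ℝ, ∀ z ∈ {z : ℂ | 0 < z.im} ∩ Metric.ball 0 R, ‖H z‖ ≤ C := by
    have h0 : ∀ᶠ z in 𝓝 (0 : ℂ), ‖H z‖ < ‖H 0‖ + 1 :=
      (hcont 0 (by simp) (by simp)).norm.eventually (gt_mem_nhds (by linarith))
    obtain ⟨δ, hδ, hball⟩ := Metric.eventually_nhds_iff.1 h0
    -- Near `0` continuity bounds `H`; elsewhere the denominator is at least `δ`.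
    refine ⟨max (‖H 0‖ + 1) (((1 + R) ^ β + 1) / δ), fun z hz => ?_⟩
    by_cases hzδ : dist z 0 < δ
    · exact (hball hzδ).le.trans (le_max_left _ _)
    · refine le_trans ?_ (le_max_right _ _)
      rw [dist_zero_right, not_lt] at hzδ
      have hz0 : z ≠ 0 := by rintro rfl; simp at hzδ; linarith
      rw [hne z hz0, norm_div]
      have hzR : ‖z‖ < R := by simpa using hz.2
      gcongr
      calc ‖(1 + z) ^ (β : ℂ) - 1‖ ≤ ‖(1 + z) ^ (β : ℂ)‖ + ‖(1 : ℂ)‖ := norm_sub_le _ _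
        _ = ‖1 + z‖ ^ β + 1 := by rw [Complex.norm_cpow_real]; simp
        _ ≤ (1 + R) ^ β + 1 := by
          gcongr
          calc ‖1 + z‖ ≤ ‖(1 : ℂ)‖ + ‖z‖ := norm_add_le _ _
            _ ≤ 1 + R := by simp; linarith
  have hopen : IsOpen {z : ℂ | 0 < z.im} := isOpen_lt continuous_const Complex.continuous_im
  have hconv : Convex ℝ ({z : ℂ | 0 < z.im} ∩ Metric.ball 0 R) :=
    (convex_halfSpace_im_gt 0).inter (convex_ball _ _)
  have hLip : LipschitzOnWith C.toNNReal (fun z => (Q z).im)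
      ({z : ℂ | 0 < z.im} ∩ Metric.ball 0 R) := by
    refine LipschitzOnWith.of_dist_le_mul fun z hz w hw => ?_
    have hb := hconv.norm_image_sub_le_of_norm_hasDerivWithin_le (𝕜 := ℂ) (f := Q) (f' := H)
      (fun z hz => (hQ z hz.1).hasDerivWithinAt) hC hw hz
    have hC0 : 0 ≤ C := (norm_nonneg _).trans (hC z hz)
    rw [Real.coe_toNNReal _ hC0, Real.dist_eq, dist_eq_norm, ← Complex.sub_im]
    exact (Complex.abs_im_le_norm _).trans hb
  -- The Lipschitz extension `G` supplies the boundary values of `Im Q`.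
  obtain ⟨G, hG, hGQ⟩ := hLip.extend_real
  have hlim : ∀ w : ℂ, ‖w‖ < R →
      Tendsto (fun z => (Q z).im) (𝓝[{z : ℂ | 0 < z.im}] w) (𝓝 (G w)) := by
    intro w hw
    refine (hG.continuous.continuousAt.continuousWithinAt.tendsto).congr' ?_
    filter_upwards [self_mem_nhdsWithin,
      mem_nhdsWithin_of_mem_nhds (Metric.isOpen_ball.mem_nhds (by simpa using hw :
        w ∈ Metric.ball 0 R))] with z hz hz'
    exact (hGQ ⟨hz, hz'⟩).symm
  -- the two boundary values agree
  set K : Set ℂ := Icc (-1) x ×ℂ Icc 0 1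
  have hKc : IsCompact K := isCompact_Icc.reProdIm isCompact_Icc
  have hKu : UniformContinuousOn H K := hKc.uniformContinuousOn_of_continuous
    fun z hz => (hcont z hz.1.1 hz.2.1).continuousWithinAt
  have hGeq : G (-1) = G x := by
    refine eq_of_forall_dist_le fun η hη => ?_
    -- `H` is real on the axis, so `Im H` is at most `η'` on a horizontal segment close to it. That
    -- segment has length `x + 1`, hence `Im Q` changes by at most `η` along it.
    set η' := η / (x + 1) with hη'
    have hη'0 : 0 < η' := by positivity
    obtain ⟨δ, hδ, hu⟩ := Metric.uniformContinuousOn_iff.1 hKu η' hη'0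
    have hev : ∀ᶠ ε : ℝ in 𝓝[>] 0, dist (G (-1 + ε * Complex.I)) (G (x + ε * Complex.I)) ≤ η := by
      have h1 : ∀ᶠ ε : ℝ in 𝓝[>] 0, ε < min δ 1 :=
        mem_nhdsWithin_of_mem_nhds (gt_mem_nhds (by positivity))
      filter_upwards [h1, self_mem_nhdsWithin] with ε hε hε0
      have hε0 : 0 < ε := hε0
      have hε1 : ε < 1 := hε.trans_le (min_le_right _ _)
      have hεδ : ε < δ := hε.trans_le (min_le_left _ _)
      have hmem : ∀ t ∈ Icc (-1) x, ((t : ℂ) + ε * Complex.I) ∈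
          {z : ℂ | 0 < z.im} ∩ Metric.ball 0 R := by
        intro t ht
        refine ⟨by simpa using hε0, ?_⟩
        rw [mem_ball_zero_iff]
        calc ‖(t : ℂ) + ε * Complex.I‖ ≤ ‖(t : ℂ)‖ + ‖ε * Complex.I‖ := norm_add_le _ _
          _ = |t| + ε := by simp [abs_of_pos hε0]
          _ < R := by
            have : |t| ≤ x + 1 := abs_le.2 ⟨by linarith [ht.1], by linarith [ht.2]⟩
            linarith
      have hder : ∀ t ∈ Icc (-1) x, HasDerivWithinAt
          (fun t : ℝ => (Q ((t : ℂ) + ε * Complex.I)).im) ((H ((t : ℂ) + ε * Complex.I)).im)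
          (Icc (-1) x) t := by
        intro t ht
        have h1 : HasDerivAt (fun t : ℝ => Q ((t : ℂ) + ε * Complex.I))
            (H ((t : ℂ) + ε * Complex.I) * 1) t :=
          (hQ _ (hmem t ht).1).comp t ((Complex.ofRealCLM.hasDerivAt (x := t)).add_const _)
        have h2 := (Complex.imCLM.hasFDerivAt.comp_hasDerivAt t h1).hasDerivWithinAt
          (s := Icc (-1) x)
        rw [mul_one] at h2
        exact h2
      have hbd : ∀ t ∈ Icc (-1) x, ‖(H ((t : ℂ) + ε * Complex.I)).im‖ ≤ η' := by
        intro t ht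
        have h1 := hu ((t : ℂ) + ε * Complex.I)
          (by simp only [K, Complex.mem_reProdIm]; simp [ht.1, ht.2, hε0.le, hε1.le]) t
          (by simp only [K, Complex.mem_reProdIm]; simp [ht.1, ht.2])
          (by simpa [dist_eq_norm, abs_of_pos hε0] using hεδ)
        rw [dist_eq_norm] at h1
        have h2 := (Complex.abs_im_le_norm _).trans h1.le
        rwa [Complex.sub_im, him t ht.1, sub_zero] at h2
      have := (convex_Icc (-1) x).norm_image_sub_le_of_norm_hasDerivWithin_le hder hbd
        (x := -1) (y := x) (left_mem_Icc.2 (by linarith)) (right_mem_Icc.2 (by linarith))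
      have e1 := hGQ (hmem (-1) (left_mem_Icc.2 (by linarith)))
      have e2 := hGQ (hmem x (right_mem_Icc.2 (by linarith)))
      push_cast at e1
      simp only at e1 e2
      rw [← e1, ← e2, dist_comm, Real.dist_eq]
      push_cast at this
      refine this.trans_eq ?_
      rw [Real.norm_of_nonneg (by linarith), hη', sub_neg_eq_add]
      field_simp
    have hl : Tendsto (fun ε : ℝ => dist (G (-1 + ε * Complex.I)) (G (x + ε * Complex.I)))
        (𝓝[>] 0) (𝓝 (dist (G (-1)) (G x))) := by
      have hc : Continuous
          (fun ε : ℝ => dist (G (-1 + ε * Complex.I)) (G (x + ε * Complex.I))) :=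
        (hG.continuous.comp (by fun_prop)).dist (hG.continuous.comp (by fun_prop))
      have := (hc.tendsto 0).mono_left (nhdsWithin_le_nhds (s := Ioi 0))
      simpa using this
    exact le_of_tendsto hl hev
  refine ⟨Q, G x, fun z hz => ?_, hlim x ?_, hGeq ▸ hlim (-1) ?_⟩
  · rw [← hne z (by rintro rfl; simp at hz)]
    exact hQ z hz
  · simp [abs_of_pos hx, hR]
  · simp [hR]; linarith

/-- The falling product `α (α - 1) ⋯ (α - k + 1) / k!`, defined recursively. -/
noncomputable def generalizedBinomial : ℕ → ℝ → ℝ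
  | 0, _ => 1
  | k + 1, α => α / (k + 1) * generalizedBinomial k (α - 1)

/-- The function `(1 + z) ^ α / z ^ (k + 1)` has a primitive on the upper half-plane whose imaginary
part has boundary values `0` at `x > 0` and `π * binomial(α, k)` at `-1`. -/
lemma exists_primitive_one_add_cpow_div_pow {x : ℝ} (hx : 0 < x) (k : ℕ) :
    ∀ α : ℝ, k < α → ∃ Φ : ℂ → ℂ, (∀ z : ℂ, 0 < z.im →
        HasDerivAt Φ ((1 + z) ^ (α : ℂ) / z ^ (k + 1)) z) ∧
      Tendsto (fun z => (Φ z).im) (𝓝[{z : ℂ | 0 < z.im}] x) (𝓝 0) ∧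
      Tendsto (fun z => (Φ z).im) (𝓝[{z : ℂ | 0 < z.im}] (-1))
        (𝓝 (Real.pi * generalizedBinomial k α)) := by
  induction k with
  | zero =>
    intro α hα
    obtain ⟨Q, c, hQ, hQx, hQ1⟩ := exists_primitive_dslope (by simpa using hα : 0 < α) hx
    -- Split off the pole: `(1+z)^α / z = 1/z + ((1+z)^α - 1)/z`. Only the logarithm contributes,
    -- its argument being `0` at `x` and `π` at `-1`.
    refine ⟨fun z => Complex.log z + (Q z - c * Complex.I), fun z hz => ?_, ?_, ?_⟩
    · have hz0 : z ≠ 0 := by rintro rfl; simp at hz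
      have := (Complex.hasDerivAt_log (Complex.mem_slitPlane_iff.2 (Or.inr hz.ne'))).add
        ((hQ z hz).sub_const (c * Complex.I))
      refine this.congr_deriv ?_
      simp only [zero_add, pow_one]
      field_simp
      ring
    · have h1 : Tendsto (fun z : ℂ => (Complex.log z).im) (𝓝[{z : ℂ | 0 < z.im}] x) (𝓝 0) := by
        have : ContinuousAt (fun z : ℂ => (Complex.log z).im) x :=
          Complex.continuous_im.continuousAt.comp
            (continuousAt_clog (Complex.mem_slitPlane_iff.2 (Or.inl (by simpa using hx))))
        have h2 := this.continuousWithinAt (s := {z : ℂ | 0 < z.im})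
        unfold ContinuousWithinAt at h2
        simpa [Complex.log_im, Complex.arg_ofReal_of_nonneg hx.le] using h2
      have := h1.add (hQx.sub_const c)
      simpa using this
    · have h1 : Tendsto (fun z : ℂ => (Complex.log z).im) (𝓝[{z : ℂ | 0 < z.im}] (-1))
          (𝓝 Real.pi) := by
        have h2 : Tendsto Complex.arg (𝓝[{z : ℂ | 0 ≤ z.im}] (-1)) (𝓝 Real.pi) :=
          Complex.tendsto_arg_nhdsWithin_im_nonneg_of_re_neg_of_im_zero (by simp) (by simp)
        simp only [Complex.log_im]
        exact h2.mono_left (nhdsWithin_mono _ fun z (hz : 0 < z.im) => hz.le)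
      have := h1.add (hQ1.sub_const c)
      simpa [generalizedBinomial] using this
  | succ k ih =>
    intro α hα
    push_cast at hα
    have hα0 : 0 < α := lt_of_le_of_lt (by positivity) hα
    -- Integration by parts lowers both `α` and the order of the pole, matching the recursion of
    -- `generalizedBinomial`. The boundary term is real on the axis, by `hbd`, so it does not affect
    -- the imaginary part.
    obtain ⟨Φ, hΦ, hΦx, hΦ1⟩ := ih (α - 1) (by linarith)
    have hk : ((k : ℂ) + 1) ≠ 0 := Nat.cast_add_one_ne_zero k
    have hbd : ∀ t : ℝ, -1 ≤ t → t ≠ 0 → Tendsto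
        (fun z : ℂ => ((1 + z) ^ (α : ℂ) / z ^ (k + 1)).im) (𝓝[{z : ℂ | 0 < z.im}] t) (𝓝 0) := by
      intro t ht ht0
      have hc : ContinuousAt (fun z : ℂ => ((1 + z) ^ (α : ℂ) / z ^ (k + 1)).im) t :=
        Complex.continuous_im.continuousAt.comp
          ((continuousAt_one_add_cpow hα0 (by simpa using ht) (by simp)).div (by fun_prop)
            (pow_ne_zero _ (by simpa using ht0)))
      have h2 := hc.continuousWithinAt (s := {z : ℂ | 0 < z.im})
      unfold ContinuousWithinAt at h2
      beta_reduce at h2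
      rw [← Complex.ofReal_pow, Complex.div_ofReal_im, one_add_cpow_ofReal_im ht, zero_div] at h2
      exact h2
    have hsplit : ∀ z : ℂ, (((α / (k + 1) : ℝ) : ℂ) * Φ z -
        ((1 / (k + 1) : ℝ) : ℂ) * ((1 + z) ^ (α : ℂ) / z ^ (k + 1))).im
        = α / (k + 1) * (Φ z).im - 1 / (k + 1) * ((1 + z) ^ (α : ℂ) / z ^ (k + 1)).im := by
      intro z
      rw [Complex.sub_im, Complex.im_ofReal_mul, Complex.im_ofReal_mul]
    refine ⟨fun z => ((α / (k + 1) : ℝ) : ℂ) * Φ z -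
        ((1 / (k + 1) : ℝ) : ℂ) * ((1 + z) ^ (α : ℂ) / z ^ (k + 1)), fun z hz => ?_, ?_, ?_⟩
    · have hz0 : z ≠ 0 := by rintro rfl; simp at hz
      have hs : 1 + z ∈ Complex.slitPlane :=
        Complex.mem_slitPlane_iff.2 (Or.inr (by simpa using hz.ne'))
      have hs0 : 1 + z ≠ 0 := Complex.slitPlane_ne_zero hs
      have h1 : HasDerivAt (fun z : ℂ => (1 + z) ^ (α : ℂ))
          ((α : ℂ) * (1 + z) ^ ((α : ℂ) - 1) * 1) z :=
        ((hasDerivAt_id z).const_add 1).cpow_const hs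
      have h2 := ((hΦ z hz).const_mul ((α / (k + 1) : ℝ) : ℂ)).sub
        ((h1.div (hasDerivAt_pow (k + 1) z) (pow_ne_zero _ hz0)).const_mul
          ((1 / (k + 1) : ℝ) : ℂ))
      refine h2.congr_deriv ?_
      have h3 : (1 + z) ^ (α : ℂ) = (1 + z) ^ ((α : ℂ) - 1) * (1 + z) := by
        rw [Complex.cpow_sub _ _ hs0, Complex.cpow_one]
        field_simp
      push_cast
      rw [h3]
      field_simp
      ring
    · have := (hΦx.const_mul (α / (k + 1))).sub
        ((hbd x (by linarith) hx.ne').const_mul (1 / ((k : ℝ) + 1)))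
      simp only [hsplit]
      simpa using this
    · have hbd1 := hbd (-1) le_rfl (by norm_num)
      rw [Complex.ofReal_neg, Complex.ofReal_one] at hbd1
      have := (hΦ1.const_mul (α / (k + 1))).sub
        (hbd1.const_mul (1 / ((k : ℝ) + 1)))
      simp only [hsplit]
      simp only [generalizedBinomial]
      convert this using 2
      ring

/-! ### The curve on which `(1 + z) ^ p / z` is real -/

/-- The distance to `-1` of the curve on which `(1 + z) ^ p / z` is real. -/
noncomputable def curveShiftedNorm (p φ : ℝ) : ℝ := Real.sin (p * φ) / Real.sin ((p - 1) * φ)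

/-- The distance to `0` of the curve on which `(1 + z) ^ p / z` is real. -/
noncomputable def curveNorm (p φ : ℝ) : ℝ := Real.sin φ / Real.sin ((p - 1) * φ)

/-- A parametrization of the curve in the upper half-plane on which `(1 + z) ^ p / z` is real. -/
noncomputable def curvePoint (p φ : ℝ) : ℂ :=
  (curveNorm p φ : ℂ) * Complex.exp ((p * φ : ℝ) * Complex.I)

/-- The value of `(1 + z) ^ p / z` along the curve. -/
noncomputable def curveValue (p φ : ℝ) : ℝ := curveShiftedNorm p φ ^ p / curveNorm p φ

/-- The imaginary part along the curve. -/
noncomputable def curveHeight (p φ : ℝ) : ℝ := curveShiftedNorm p φ * Real.sin φ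

lemma curve_sin_pos {p φ : ℝ} (hp : 1 < p) (hφ : φ ∈ Ioo 0 (Real.pi / p)) :
    0 < Real.sin φ ∧ 0 < Real.sin (p * φ) ∧ 0 < Real.sin ((p - 1) * φ) := by
  have h0 : 0 < φ := hφ.1
  have h1 : p * φ < Real.pi := by
    have := hφ.2
    rw [lt_div_iff₀ (by linarith)] at this
    linarith
  have h2 : 0 < (p - 1) * φ := mul_pos (by linarith) h0
  refine ⟨Real.sin_pos_of_pos_of_lt_pi h0 ?_, Real.sin_pos_of_pos_of_lt_pi (by nlinarith) h1,
    Real.sin_pos_of_pos_of_lt_pi h2 ?_⟩ <;> nlinarith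

lemma sin_sub_one_mul (p φ : ℝ) : Real.sin ((p - 1) * φ)
    = Real.sin (p * φ) * Real.cos φ - Real.cos (p * φ) * Real.sin φ := by
  rw [sub_mul, one_mul, Real.sin_sub]

lemma cos_sub_one_mul (p φ : ℝ) : Real.cos ((p - 1) * φ)
    = Real.cos (p * φ) * Real.cos φ + Real.sin (p * φ) * Real.sin φ := by
  rw [sub_mul, one_mul, Real.cos_sub]

lemma curveShiftedNorm_pos {p φ : ℝ} (hp : 1 < p) (hφ : φ ∈ Ioo 0 (Real.pi / p)) :
    0 < curveShiftedNorm p φ :=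
  div_pos (curve_sin_pos hp hφ).2.1 (curve_sin_pos hp hφ).2.2

lemma curveNorm_pos {p φ : ℝ} (hp : 1 < p) (hφ : φ ∈ Ioo 0 (Real.pi / p)) :
    0 < curveNorm p φ :=
  div_pos (curve_sin_pos hp hφ).1 (curve_sin_pos hp hφ).2.2

lemma curveValue_pos {p φ : ℝ} (hp : 1 < p) (hφ : φ ∈ Ioo 0 (Real.pi / p)) :
    0 < curveValue p φ :=
  div_pos (Real.rpow_pos_of_pos (curveShiftedNorm_pos hp hφ) _) (curveNorm_pos hp hφ)

lemma curveHeight_pos {p φ : ℝ} (hp : 1 < p) (hφ : φ ∈ Ioo 0 (Real.pi / p)) :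
    0 < curveHeight p φ :=
  mul_pos (curveShiftedNorm_pos hp hφ) (curve_sin_pos hp hφ).1

lemma curvePoint_im (p φ : ℝ) : (curvePoint p φ).im = curveHeight p φ := by
  rw [curvePoint, Complex.im_ofReal_mul, Complex.exp_ofReal_mul_I_im, curveHeight, curveNorm,
    curveShiftedNorm]
  ring

/-- This is the law of sines in the triangle `-1, 0, z`, with angles `φ`, `π - pφ` and `(p-1)φ`.
Since `arg z = p · arg(1+z)`, the phases in `(1+z)^p / z` cancel. -/
lemma one_add_curvePoint {p φ : ℝ} (hp : 1 < p) (hφ : φ ∈ Ioo 0 (Real.pi / p)) :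
    1 + curvePoint p φ = (curveShiftedNorm p φ : ℂ) * Complex.exp (φ * Complex.I) := by
  have hd := (curve_sin_pos hp hφ).2.2
  apply Complex.ext
  · rw [curvePoint, Complex.add_re, Complex.re_ofReal_mul, Complex.re_ofReal_mul,
      Complex.exp_ofReal_mul_I_re, Complex.exp_ofReal_mul_I_re, Complex.one_re, curveNorm,
      curveShiftedNorm]
    field_simp
    rw [sin_sub_one_mul]
    ring
  · rw [Complex.add_im, curvePoint_im, Complex.im_ofReal_mul, Complex.exp_ofReal_mul_I_im,
      curveHeight]
    simp

/-- Along the curve, `(1 + z) ^ p / z` and its powers are real. -/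
lemma curve_integrand_eq {p φ : ℝ} (hp : 1 < p) (hφ : φ ∈ Ioo 0 (Real.pi / p)) (k : ℕ) :
    (1 + curvePoint p φ) ^ ((((k + 1 : ℕ) : ℝ) * p : ℝ) : ℂ) / curvePoint p φ ^ (k + 1)
      = ((curveValue p φ ^ (k + 1) : ℝ) : ℂ) := by
  have hA := curveShiftedNorm_pos hp hφ
  have hB := curveNorm_pos hp hφ
  have hφπ : φ ≤ Real.pi := by
    have := hφ.2
    rw [lt_div_iff₀ (by linarith)] at this
    nlinarith [hφ.1]
  -- The principal branch is the right one because `0 < φ ≤ π`.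
  have hlog : Complex.log (Complex.exp (φ * Complex.I)) = φ * Complex.I :=
    Complex.log_exp (by simp; linarith [hφ.1, Real.pi_pos]) (by simpa using hφπ)
  have h1 : (1 + curvePoint p φ) ^ ((((k + 1 : ℕ) : ℝ) * p : ℝ) : ℂ)
      = (((curveShiftedNorm p φ ^ p) ^ (k + 1) : ℝ) : ℂ)
        * Complex.exp ((p * φ : ℝ) * Complex.I) ^ (k + 1) := by
    have hA' : (curveShiftedNorm p φ : ℂ) ≠ 0 := Complex.ofReal_ne_zero.2 hA.ne'
    rw [one_add_curvePoint hp hφ, Complex.cpow_def_of_ne_zero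
      (mul_ne_zero hA' (Complex.exp_ne_zero _)), Complex.log_ofReal_mul hA (Complex.exp_ne_zero _),
      hlog, Real.rpow_def_of_pos hA]
    push_cast
    rw [← Complex.exp_nat_mul, ← Complex.exp_nat_mul, ← Complex.exp_add]
    congr 1
    push_cast
    ring
  rw [h1, curvePoint, mul_pow, mul_div_mul_right _ _ (pow_ne_zero _ (Complex.exp_ne_zero _)),
    curveValue, div_pow]
  push_cast
  rfl

/-! ### Derivatives along the curve -/

lemma hasDerivAt_sin_mul (a φ : ℝ) :
    HasDerivAt (fun φ : ℝ => Real.sin (a * φ)) (a * Real.cos (a * φ)) φ := by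
  have := (Real.hasDerivAt_sin (a * φ)).comp φ ((hasDerivAt_id φ).const_mul a)
  refine this.congr_deriv ?_
  ring

lemma hasDerivAt_curveShiftedNorm {p φ : ℝ} (hp : 1 < p) (hφ : φ ∈ Ioo 0 (Real.pi / p)) :
    HasDerivAt (curveShiftedNorm p)
      ((p * Real.cos (p * φ) * Real.sin ((p - 1) * φ)
        - Real.sin (p * φ) * ((p - 1) * Real.cos ((p - 1) * φ))) / Real.sin ((p - 1) * φ) ^ 2) φ :=
  (hasDerivAt_sin_mul p φ).div (hasDerivAt_sin_mul (p - 1) φ) (curve_sin_pos hp hφ).2.2.ne'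

lemma hasDerivAt_curveNorm {p φ : ℝ} (hp : 1 < p) (hφ : φ ∈ Ioo 0 (Real.pi / p)) :
    HasDerivAt (curveNorm p)
      ((Real.cos φ * Real.sin ((p - 1) * φ)
        - Real.sin φ * ((p - 1) * Real.cos ((p - 1) * φ))) / Real.sin ((p - 1) * φ) ^ 2) φ :=
  (Real.hasDerivAt_sin φ).div (hasDerivAt_sin_mul (p - 1) φ) (curve_sin_pos hp hφ).2.2.ne'

/-- In this form the sign is decided by comparing `sin(pφ) / sin φ` with `√p`. -/
lemma hasDerivAt_curveHeight {p φ : ℝ} (hp : 1 < p) (hφ : φ ∈ Ioo 0 (Real.pi / p)) :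
    HasDerivAt (curveHeight p)
      ((Real.sin (p * φ) ^ 2 - p * Real.sin φ ^ 2) / Real.sin ((p - 1) * φ) ^ 2) φ := by
  have hd := (curve_sin_pos hp hφ).2.2
  refine ((hasDerivAt_curveShiftedNorm hp hφ).mul (Real.hasDerivAt_sin φ)).congr_deriv ?_
  rw [curveShiftedNorm]
  have e1 := sin_sub_one_mul p φ
  have e2 := cos_sub_one_mul p φ
  generalize Real.sin ((p - 1) * φ) = d at hd e1 ⊢
  generalize Real.cos ((p - 1) * φ) = e at e2 ⊢
  field_simp
  rw [e1, e2]
  linear_combination (-p * Real.sin φ ^ 2) * Real.sin_sq_add_cos_sq (p * φ)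
    + Real.sin (p * φ) ^ 2 * Real.sin_sq_add_cos_sq φ

/-- The velocity `z'` is left implicit: the moment computation only needs its imaginary part to be
the derivative of the height. -/
lemma exists_hasDerivAt_curvePoint {p φ : ℝ} (hp : 1 < p) (hφ : φ ∈ Ioo 0 (Real.pi / p)) :
    ∃ z' : ℂ, HasDerivAt (curvePoint p) z' φ ∧ HasDerivAt (curveHeight p) z'.im φ := by
  have hd : DifferentiableAt ℝ (curvePoint p) φ := by
    have h1 : DifferentiableAt ℝ (fun φ : ℝ => ((curveNorm p φ : ℝ) : ℂ)) φ :=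
      (hasDerivAt_curveNorm hp hφ).ofReal_comp.differentiableAt
    have h2 : DifferentiableAt ℝ
        (fun φ : ℝ => Complex.exp (((p * φ : ℝ) : ℂ) * Complex.I)) φ :=
      ((((hasDerivAt_id φ).const_mul p).ofReal_comp).mul_const Complex.I).cexp.differentiableAt
    exact h1.mul h2
  refine ⟨_, hd.hasDerivAt, ?_⟩
  have h := Complex.imCLM.hasFDerivAt.comp_hasDerivAt φ hd.hasDerivAt
  have e : curveHeight p = Complex.imCLM ∘ curvePoint p := by
    funext φ
    exact (curvePoint_im p φ).symm
  rw [e]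
  exact h

/-- The logarithmic derivative is put as minus a sum of two squares over a positive product, so that
its sign is visible. -/
lemma hasDerivAt_curveValue {p φ : ℝ} (hp : 1 < p) (hφ : φ ∈ Ioo 0 (Real.pi / p)) :
    HasDerivAt (curveValue p)
      (-curveValue p φ * (((p * Real.cos (p * φ) * Real.sin φ - Real.cos φ * Real.sin (p * φ)) ^ 2
        + ((p - 1) * (Real.sin φ * Real.sin (p * φ))) ^ 2)
        / (Real.sin φ * Real.sin (p * φ) * Real.sin ((p - 1) * φ)))) φ := by
  obtain ⟨hs, hS, hd⟩ := curve_sin_pos hp hφ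
  have hA := curveShiftedNorm_pos hp hφ
  have hB := curveNorm_pos hp hφ
  refine (((hasDerivAt_curveShiftedNorm hp hφ).rpow_const (p := p) (Or.inl hA.ne')).div
    (hasDerivAt_curveNorm hp hφ) hB.ne').congr_deriv ?_
  rw [curveValue, Real.rpow_sub hA, Real.rpow_one]
  generalize curveShiftedNorm p φ ^ p = W
  rw [curveShiftedNorm, curveNorm]
  have e1 := sin_sub_one_mul p φ
  have e2 := cos_sub_one_mul p φ
  generalize Real.sin ((p - 1) * φ) = d at hd e1 ⊢
  generalize Real.cos ((p - 1) * φ) = e at e2 ⊢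
  field_simp
  rw [e1, e2]
  ring

lemma exists_hasDerivAt_curveValue_neg {p φ : ℝ} (hp : 1 < p) (hφ : φ ∈ Ioo 0 (Real.pi / p)) :
    ∃ r < 0, HasDerivAt (curveValue p) r φ := by
  refine ⟨_, ?_, hasDerivAt_curveValue hp hφ⟩
  obtain ⟨hs, hS, hd⟩ := curve_sin_pos hp hφ
  have hv := curveValue_pos hp hφ
  have hp1 : 0 < p - 1 := by linarith
  rw [neg_mul, neg_lt_zero]
  positivity

lemma strictAntiOn_curveValue {p : ℝ} (hp : 1 < p) :
    StrictAntiOn (curveValue p) (Ioo 0 (Real.pi / p)) := by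
  refine strictAntiOn_of_deriv_neg (convex_Ioo _ _) (fun φ hφ => ?_) fun φ hφ => ?_
  · obtain ⟨r, -, hr⟩ := exists_hasDerivAt_curveValue_neg hp hφ
    exact hr.continuousAt.continuousWithinAt
  · rw [interior_Ioo] at hφ
    obtain ⟨r, hr0, hr⟩ := exists_hasDerivAt_curveValue_neg hp hφ
    rwa [hr.deriv]

/-! ### Limits at the two ends of the curve -/

lemma tendsto_sin_mul_div_sin_mul (a : ℝ) {b : ℝ} (hb : b ≠ 0) :
    Tendsto (fun φ : ℝ => Real.sin (a * φ) / Real.sin (b * φ)) (𝓝[>] 0) (𝓝 (a / b)) := by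
  have h : ∀ c : ℝ, Tendsto (fun φ : ℝ => φ⁻¹ * Real.sin (c * φ)) (𝓝[>] 0) (𝓝 c) := by
    intro c
    have := (hasDerivAt_sin_mul c 0).tendsto_slope_zero_right
    simpa using this
  refine ((h a).div (h b) hb).congr' ?_
  filter_upwards [self_mem_nhdsWithin] with φ hφ
  have : φ ≠ 0 := (mem_Ioi.1 hφ).ne'
  rw [Pi.div_apply, mul_div_mul_left _ _ (inv_ne_zero this)]

lemma tendsto_curveShiftedNorm_zero {p : ℝ} (hp : 1 < p) :
    Tendsto (curveShiftedNorm p) (𝓝[>] 0) (𝓝 (p / (p - 1))) :=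
  tendsto_sin_mul_div_sin_mul p (by linarith)

lemma tendsto_curveNorm_zero {p : ℝ} (hp : 1 < p) :
    Tendsto (curveNorm p) (𝓝[>] 0) (𝓝 (1 / (p - 1))) := by
  have e : curveNorm p = fun φ => Real.sin φ / Real.sin ((p - 1) * φ) := rfl
  simpa [e] using tendsto_sin_mul_div_sin_mul 1 (b := p - 1) (by linarith)

/-- The limit `1/(p-1)` is the critical point of `(1+z)^p / z`, where the curve meets the positive
axis. -/
lemma tendsto_curvePoint_zero {p : ℝ} (hp : 1 < p) :
    Tendsto (curvePoint p) (𝓝[>] 0) (𝓝 ((1 / (p - 1) : ℝ) : ℂ)) := by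
  have h1 : Tendsto (fun φ => ((curveNorm p φ : ℝ) : ℂ)) (𝓝[>] 0) (𝓝 ((1 / (p - 1) : ℝ) : ℂ)) :=
    (Complex.continuous_ofReal.tendsto _).comp (tendsto_curveNorm_zero hp)
  have h2 : Tendsto (fun φ : ℝ => Complex.exp ((p * φ : ℝ) * Complex.I)) (𝓝[>] 0) (𝓝 1) := by
    have hc : Continuous (fun φ : ℝ => Complex.exp ((p * φ : ℝ) * Complex.I)) := by fun_prop
    simpa using (hc.tendsto 0).mono_left (nhdsWithin_le_nhds (s := Ioi 0))
  have e : curvePoint p =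
      fun φ => (curveNorm p φ : ℂ) * Complex.exp ((p * φ : ℝ) * Complex.I) := rfl
  simpa [e] using h1.mul h2

lemma tendsto_curveValue_zero {p : ℝ} (hp : 1 < p) :
    Tendsto (curveValue p) (𝓝[>] 0) (𝓝 ((p / (p - 1)) ^ p / (1 / (p - 1)))) := by
  have hp1 : 0 < p - 1 := by linarith
  exact ((tendsto_curveShiftedNorm_zero hp).rpow_const (Or.inr (by linarith))).div
    (tendsto_curveNorm_zero hp) (by positivity)

lemma tendsto_curveHeight_zero {p : ℝ} (hp : 1 < p) :
    Tendsto (curveHeight p) (𝓝[>] 0) (𝓝 0) := by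
  have := (Real.continuous_sin.tendsto 0).mono_left (nhdsWithin_le_nhds (s := Ioi 0))
  have e : curveHeight p = fun φ => curveShiftedNorm p φ * Real.sin φ := rfl
  simpa [e] using (tendsto_curveShiftedNorm_zero hp).mul this

lemma sin_pi_div_pos {p : ℝ} (hp : 1 < p) : 0 < Real.sin (Real.pi / p) :=
  Real.sin_pos_of_pos_of_lt_pi (div_pos Real.pi_pos (by linarith)) (div_lt_self Real.pi_pos hp)

lemma sin_sub_one_mul_pi_div {p : ℝ} (hp : 1 < p) :
    Real.sin ((p - 1) * (Real.pi / p)) = Real.sin (Real.pi / p) := by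
  rw [sub_mul, one_mul, mul_div_cancel₀ _ (by linarith), Real.sin_pi_sub]

lemma tendsto_curveShiftedNorm_end {p : ℝ} (hp : 1 < p) :
    Tendsto (curveShiftedNorm p) (𝓝[<] (Real.pi / p)) (𝓝 0) := by
  have h : ContinuousAt (curveShiftedNorm p) (Real.pi / p) :=
    ContinuousAt.div (by fun_prop) (by fun_prop)
      (by rw [sin_sub_one_mul_pi_div hp]; exact (sin_pi_div_pos hp).ne')
  have h2 := h.tendsto.mono_left (nhdsWithin_le_nhds (s := Iio (Real.pi / p)))
  rwa [curveShiftedNorm, mul_div_cancel₀ _ (by linarith), Real.sin_pi, zero_div] at h2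

lemma tendsto_curveNorm_end {p : ℝ} (hp : 1 < p) :
    Tendsto (curveNorm p) (𝓝[<] (Real.pi / p)) (𝓝 1) := by
  have h : ContinuousAt (curveNorm p) (Real.pi / p) :=
    ContinuousAt.div (by fun_prop) (by fun_prop)
      (by rw [sin_sub_one_mul_pi_div hp]; exact (sin_pi_div_pos hp).ne')
  have h2 := h.tendsto.mono_left (nhdsWithin_le_nhds (s := Iio (Real.pi / p)))
  rwa [curveNorm, sin_sub_one_mul_pi_div hp, div_self (sin_pi_div_pos hp).ne'] at h2

lemma tendsto_curvePoint_end {p : ℝ} (hp : 1 < p) :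
    Tendsto (curvePoint p) (𝓝[<] (Real.pi / p)) (𝓝 (-1)) := by
  have h1 : Tendsto (fun φ => ((curveNorm p φ : ℝ) : ℂ)) (𝓝[<] (Real.pi / p))
      (𝓝 ((1 : ℝ) : ℂ)) :=
    (Complex.continuous_ofReal.tendsto _).comp (tendsto_curveNorm_end hp)
  have h2 : Tendsto (fun φ : ℝ => Complex.exp ((p * φ : ℝ) * Complex.I)) (𝓝[<] (Real.pi / p))
      (𝓝 (-1)) := by
    have hc : Continuous (fun φ : ℝ => Complex.exp ((p * φ : ℝ) * Complex.I)) := by fun_prop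
    have := (hc.tendsto (Real.pi / p)).mono_left (nhdsWithin_le_nhds (s := Iio (Real.pi / p)))
    rwa [mul_div_cancel₀ _ (by linarith), Complex.exp_pi_mul_I] at this
  have e : curvePoint p =
      fun φ => (curveNorm p φ : ℂ) * Complex.exp ((p * φ : ℝ) * Complex.I) := rfl
  simpa [e] using h1.mul h2

lemma tendsto_curveValue_end {p : ℝ} (hp : 1 < p) :
    Tendsto (curveValue p) (𝓝[<] (Real.pi / p)) (𝓝 0) := by
  have := ((tendsto_curveShiftedNorm_end hp).rpow_const (p := p) (Or.inr (by linarith))).div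
    (tendsto_curveNorm_end hp) one_ne_zero
  rwa [Real.zero_rpow (by linarith), zero_div] at this

lemma tendsto_curveHeight_end {p : ℝ} (hp : 1 < p) :
    Tendsto (curveHeight p) (𝓝[<] (Real.pi / p)) (𝓝 0) := by
  have := (Real.continuous_sin.tendsto (Real.pi / p)).mono_left
    (nhdsWithin_le_nhds (s := Iio (Real.pi / p)))
  have e : curveHeight p = fun φ => curveShiftedNorm p φ * Real.sin φ := rfl
  simpa [e] using (tendsto_curveShiftedNorm_end hp).mul this

/-- By monotonicity the limit at `φ = 0` is the supremum; it equals `p^p / (p-1)^(p-1)`, the right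
end of the support. -/
lemma curveValue_le {p φ : ℝ} (hp : 1 < p) (hφ : φ ∈ Ioo 0 (Real.pi / p)) :
    curveValue p φ ≤ (p / (p - 1)) ^ p / (1 / (p - 1)) := by
  refine ge_of_tendsto (tendsto_curveValue_zero hp) ?_
  filter_upwards [Ioo_mem_nhdsGT hφ.1] with ψ hψ
  exact (strictAntiOn_curveValue hp ⟨hψ.1, hψ.2.trans hφ.2⟩ hφ hψ.2).le

/-! ### The height has a single peak -/

lemma antitoneOn_sin_mul_div_sin {p : ℝ} (hp : 1 < p) :
    AntitoneOn (fun φ => Real.sin (p * φ) / Real.sin φ) (Ioo 0 (Real.pi / p)) := by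
  have hder : ∀ φ ∈ Ioo 0 (Real.pi / p), HasDerivAt (fun φ => Real.sin (p * φ) / Real.sin φ)
      ((p * Real.cos (p * φ) * Real.sin φ - Real.sin (p * φ) * Real.cos φ) / Real.sin φ ^ 2) φ :=
    fun φ hφ => (hasDerivAt_sin_mul p φ).div (Real.hasDerivAt_sin φ) (curve_sin_pos hp hφ).1.ne'
  -- The numerator of the derivative vanishes at `0` and has derivative `-(p²-1) sin(pφ) sin φ ≤ 0`,
  -- so it is nonpositive.
  have hnum : AntitoneOn
      (fun φ => p * Real.cos (p * φ) * Real.sin φ - Real.sin (p * φ) * Real.cos φ)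
      (Icc 0 (Real.pi / p)) := by
    have hcos : ∀ φ : ℝ, HasDerivAt (fun φ : ℝ => Real.cos (p * φ)) (-(p * Real.sin (p * φ))) φ :=
      fun φ => ((Real.hasDerivAt_cos (p * φ)).comp φ ((hasDerivAt_id φ).const_mul p)).congr_deriv
        (by ring)
    refine antitoneOn_of_deriv_nonpos (convex_Icc _ _) (by fun_prop) (by fun_prop) fun φ hφ => ?_
    rw [interior_Icc] at hφ
    obtain ⟨hs, hS, -⟩ := curve_sin_pos hp hφ
    have h := (((hcos φ).const_mul p).mul (Real.hasDerivAt_sin φ)).sub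
      ((hasDerivAt_sin_mul p φ).mul (Real.hasDerivAt_cos φ))
    have h' := h.deriv
    have e : p * -(p * Real.sin (p * φ)) * Real.sin φ + p * Real.cos (p * φ) * Real.cos φ
        - (p * Real.cos (p * φ) * Real.cos φ + Real.sin (p * φ) * -Real.sin φ)
        = -((p ^ 2 - 1) * (Real.sin (p * φ) * Real.sin φ)) := by ring
    rw [e] at h'
    refine (h'.trans_le ?_)
    have : 0 < p ^ 2 - 1 := by nlinarith
    rw [neg_nonpos]
    positivity
  refine antitoneOn_of_deriv_nonpos (convex_Ioo _ _)
    (fun φ hφ => (hder φ hφ).continuousAt.continuousWithinAt) (fun φ hφ => ?_) fun φ hφ => ?_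
  · rw [interior_Ioo] at hφ
    exact (hder φ hφ).differentiableAt.differentiableWithinAt
  · rw [interior_Ioo] at hφ
    rw [(hder φ hφ).deriv]
    refine div_nonpos_of_nonpos_of_nonneg ?_ (sq_nonneg _)
    have := hnum (left_mem_Icc.2 (hφ.1.trans hφ.2).le) (Ioo_subset_Icc_self hφ) hφ.1.le
    simpa using this

/-- The height of the curve first increases and then decreases. -/
lemma exists_curveHeight_mode {p : ℝ} (hp : 1 < p) : ∃ c ∈ Ioo 0 (Real.pi / p),
    MonotoneOn (curveHeight p) (Ioc 0 c) ∧ AntitoneOn (curveHeight p) (Ico c (Real.pi / p)) := by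
  have hp0 : 0 < p := by linarith
  have hI : 0 < Real.pi / p := div_pos Real.pi_pos hp0
  have hsq : Real.sqrt p ^ 2 = p := Real.sq_sqrt hp0.le
  have hsp : 0 < Real.sqrt p := Real.sqrt_pos.2 hp0
  have hlt : Real.sqrt p < p := by nlinarith
  have hcont : ContinuousOn (fun φ => Real.sin (p * φ) / Real.sin φ) (Ioo 0 (Real.pi / p)) :=
    ContinuousOn.div (by fun_prop) (by fun_prop) fun φ hφ => (curve_sin_pos hp hφ).1.ne'
  -- The ratio tends to `p > √p` at `0` and to `0` at `π/p`, so it takes the value `√p` at some `c`.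
  obtain ⟨a, ha, haI⟩ : ∃ a, Real.sqrt p < Real.sin (p * a) / Real.sin a ∧
      a ∈ Ioo 0 (Real.pi / p) := by
    have h1 := tendsto_sin_mul_div_sin_mul p (b := 1) one_ne_zero
    simp only [one_mul, div_one] at h1
    exact ((h1.eventually (lt_mem_nhds hlt)).and (Ioo_mem_nhdsGT hI)).exists
  obtain ⟨b, hb, hbI⟩ : ∃ b, Real.sin (p * b) / Real.sin b < Real.sqrt p ∧
      b ∈ Ioo 0 (Real.pi / p) := by
    have h : ContinuousAt (fun φ => Real.sin (p * φ) / Real.sin φ) (Real.pi / p) :=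
      ContinuousAt.div (by fun_prop) (by fun_prop) (sin_pi_div_pos hp).ne'
    have h2 := h.tendsto.mono_left (nhdsWithin_le_nhds (s := Iio (Real.pi / p)))
    rw [mul_div_cancel₀ _ (by linarith), Real.sin_pi, zero_div] at h2
    exact ((h2.eventually (gt_mem_nhds hsp)).and (Ioo_mem_nhdsLT hI)).exists
  obtain ⟨c, hc, hceq⟩ := isPreconnected_Ioo.intermediate_value hbI haI hcont ⟨hb.le, ha.le⟩
  simp only at hceq
  have hanti := antitoneOn_sin_mul_div_sin hp
  refine ⟨c, hc, ?_, ?_⟩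
  · have hsub : Ioc 0 c ⊆ Ioo 0 (Real.pi / p) := fun φ hφ => ⟨hφ.1, hφ.2.trans_lt hc.2⟩
    refine monotoneOn_of_deriv_nonneg (convex_Ioc _ _)
      (fun φ hφ => (hasDerivAt_curveHeight hp (hsub hφ)).continuousAt.continuousWithinAt)
      (fun φ hφ => ?_) fun φ hφ => ?_
    · exact (hasDerivAt_curveHeight hp
        (hsub (interior_subset hφ))).differentiableAt.differentiableWithinAt
    · have hφ' := interior_subset hφ
      have hφI := hsub hφ'
      obtain ⟨hs, hS, hd⟩ := curve_sin_pos hp hφI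
      rw [(hasDerivAt_curveHeight hp hφI).deriv]
      have h := hanti hφI hc hφ'.2
      simp only [hceq] at h
      rw [le_div_iff₀ hs] at h
      refine div_nonneg ?_ (sq_nonneg _)
      have := pow_le_pow_left₀ (by positivity) h 2
      rw [mul_pow, hsq] at this
      linarith
  · have hsub : Ico c (Real.pi / p) ⊆ Ioo 0 (Real.pi / p) := fun φ hφ =>
      ⟨hc.1.trans_le hφ.1, hφ.2⟩
    refine antitoneOn_of_deriv_nonpos (convex_Ico _ _)
      (fun φ hφ => (hasDerivAt_curveHeight hp (hsub hφ)).continuousAt.continuousWithinAt)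
      (fun φ hφ => ?_) fun φ hφ => ?_
    · exact (hasDerivAt_curveHeight hp
        (hsub (interior_subset hφ))).differentiableAt.differentiableWithinAt
    · have hφ' := interior_subset hφ
      have hφI := hsub hφ'
      obtain ⟨hs, hS, hd⟩ := curve_sin_pos hp hφI
      rw [(hasDerivAt_curveHeight hp hφI).deriv]
      have h := hanti hc hφI hφ'.1
      simp only [hceq] at h
      rw [div_le_iff₀ hs] at h
      refine div_nonpos_of_nonpos_of_nonneg ?_ (sq_nonneg _)
      have := pow_le_pow_left₀ hS.le h 2
      rw [mul_pow, hsq] at this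
      linarith

/-! ### Moments as integrals along the curve -/

/-- The fundamental theorem of calculus on an open interval for a nonnegative derivative. -/
lemma integral_Ioo_of_hasDerivAt_of_nonneg {F F' : ℝ → ℝ} {a b la lb : ℝ} (hab : a < b)
    (hF : ∀ x ∈ Ioo a b, HasDerivAt F (F' x) x) (hF' : ∀ x ∈ Ioo a b, 0 ≤ F' x)
    (ha : Tendsto F (𝓝[>] a) (𝓝 la)) (hb : Tendsto F (𝓝[<] b) (𝓝 lb)) :
    IntegrableOn F' (Ioo a b) ∧ ∫ x in Ioo a b, F' x = lb - la := by
  have hcont : ContinuousOn F (Ioo a b) := fun x hx => (hF x hx).continuousAt.continuousWithinAt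
  have hext : ContinuousOn (extendFrom (Ioo a b) F) (Icc a b) :=
    continuousOn_Icc_extendFrom_Ioo hcont ha hb
  have hder : ∀ x ∈ Ioo a b, HasDerivAt (extendFrom (Ioo a b) F) (F' x) x := by
    intro x hx
    refine (hF x hx).congr_of_eventuallyEq ?_
    filter_upwards [isOpen_Ioo.mem_nhds hx] with y hy
    exact extendFrom_eq (subset_closure hy) (hcont y hy)
  have hint : IntegrableOn F' (Ioc a b) :=
    intervalIntegral.integrableOn_deriv_of_nonneg hext hder hF'
  refine ⟨hint.mono_set Ioo_subset_Ioc_self, ?_⟩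
  rw [← integral_Ioc_eq_integral_Ioo, ← intervalIntegral.integral_of_le hab.le]
  exact intervalIntegral.integral_eq_sub_of_hasDerivAt_of_tendsto hab hF
    ((intervalIntegrable_iff_integrableOn_Ioc_of_le hab.le).2 hint) ha hb

/-- Here the contour integral is evaluated. `|ρ'|` is the Jacobian of the later substitution `x =
ρ(φ)`. -/
lemma curve_moment {p : ℝ} (hp : 1 < p) (k : ℕ) :
    IntegrableOn (fun φ => |deriv (curveValue p) φ| *
        (curveValue p φ ^ k * (curveHeight p φ / Real.pi))) (Ioo 0 (Real.pi / p)) ∧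
      ∫ φ in Ioo 0 (Real.pi / p), |deriv (curveValue p) φ| *
        (curveValue p φ ^ k * (curveHeight p φ / Real.pi))
      = generalizedBinomial k ((k + 1) * p) / (k + 1) := by
  have hp0 : 0 < p := by linarith
  have hI : 0 < Real.pi / p := div_pos Real.pi_pos hp0
  have hk : (0 : ℝ) < k + 1 := by positivity
  have hx : 0 < 1 / (p - 1) := one_div_pos.2 (by linarith)
  obtain ⟨Φ, hΦ, hΦ0, hΦ1⟩ := exists_primitive_one_add_cpow_div_pow hx k (((k + 1 : ℕ) : ℝ) * p)
    (by push_cast; nlinarith)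
  have him : ∀ φ ∈ Ioo 0 (Real.pi / p), 0 < (curvePoint p φ).im := fun φ hφ => by
    rw [curvePoint_im]
    exact curveHeight_pos hp hφ
  -- Integration by parts written as an antiderivative: `Im Φ(z)` contributes `ρ^(k+1) g'`, with `g`
  -- the height. Subtracting `ρ^(k+1) g` leaves `-(k+1) ρ^k ρ' g`, and `-ρ' = |ρ'|`.
  have hder : ∀ φ ∈ Ioo 0 (Real.pi / p), HasDerivAt
      (fun φ => ((Φ (curvePoint p φ)).im - curveValue p φ ^ (k + 1) * curveHeight p φ)
        / ((k + 1) * Real.pi))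
      (|deriv (curveValue p) φ| * (curveValue p φ ^ k * (curveHeight p φ / Real.pi))) φ := by
    intro φ hφ
    obtain ⟨r, hr0, hr⟩ := exists_hasDerivAt_curveValue_neg hp hφ
    obtain ⟨z', hz, hg⟩ := exists_hasDerivAt_curvePoint hp hφ
    have h1 : HasDerivAt (fun φ => Φ (curvePoint p φ))
        (((curveValue p φ ^ (k + 1) : ℝ) : ℂ) * z') φ := by
      have := (hΦ _ (him φ hφ)).comp φ hz
      rwa [curve_integrand_eq hp hφ] at this
    have h2 : HasDerivAt (fun φ => (Φ (curvePoint p φ)).im)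
        (((curveValue p φ ^ (k + 1) : ℝ) : ℂ) * z').im φ :=
      Complex.imCLM.hasFDerivAt.comp_hasDerivAt φ h1
    refine ((h2.sub ((hr.pow (k + 1)).mul hg)).div_const _).congr_deriv ?_
    rw [hr.deriv, abs_of_neg hr0, Complex.im_ofReal_mul, Nat.add_sub_cancel, Pi.pow_apply]
    have := Real.pi_ne_zero
    push_cast
    field_simp
    ring
  have hnhds0 : Tendsto (curvePoint p) (𝓝[>] 0)
      (𝓝[{z : ℂ | 0 < z.im}] ((1 / (p - 1) : ℝ) : ℂ)) :=
    tendsto_nhdsWithin_iff.2 ⟨tendsto_curvePoint_zero hp, by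
      filter_upwards [Ioo_mem_nhdsGT hI] with φ hφ using him φ hφ⟩
  have hnhds1 : Tendsto (curvePoint p) (𝓝[<] (Real.pi / p)) (𝓝[{z : ℂ | 0 < z.im}] (-1)) :=
    tendsto_nhdsWithin_iff.2 ⟨tendsto_curvePoint_end hp, by
      filter_upwards [Ioo_mem_nhdsLT hI] with φ hφ using him φ hφ⟩
  -- The height vanishes at both ends, so only the boundary values of `Im Φ` remain.
  have hl0 := ((hΦ0.comp hnhds0).sub
    (((tendsto_curveValue_zero hp).pow (k + 1)).mul (tendsto_curveHeight_zero hp))).div_const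
      (((k : ℝ) + 1) * Real.pi)
  have hl1 := ((hΦ1.comp hnhds1).sub
    (((tendsto_curveValue_end hp).pow (k + 1)).mul (tendsto_curveHeight_end hp))).div_const
      (((k : ℝ) + 1) * Real.pi)
  have hres := integral_Ioo_of_hasDerivAt_of_nonneg hI hder (fun φ hφ => by
    have := curveValue_pos hp hφ
    have := curveHeight_pos hp hφ
    positivity) hl0 hl1
  refine ⟨hres.1, hres.2.trans ?_⟩
  have := Real.pi_ne_zero
  push_cast
  field_simp
  ring

lemma generalizedBinomial_eq_prod (k : ℕ) : ∀ α : ℝ,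
    generalizedBinomial k α = (∏ i ∈ Finset.range k, (α - i)) / k.factorial := by
  induction k with
  | zero => simp [generalizedBinomial]
  | succ k ih =>
    intro α
    rw [generalizedBinomial, ih, Finset.prod_range_succ', Nat.factorial_succ]
    have : ∀ i ∈ Finset.range k, α - 1 - (i : ℝ) = α - ((i + 1 : ℕ) : ℝ) := fun i _ => by
      push_cast; ring
    rw [Finset.prod_congr rfl this]
    push_cast
    have := Nat.factorial_ne_zero k
    field_simp
    ring

lemma generalizedBinomial_div_eq_fussCatalanNumber (p : ℝ) (k : ℕ) :
    generalizedBinomial k ((k + 1) * p) / (k + 1) = fussCatalanNumber p p k := by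
  cases k with
  | zero => simp [generalizedBinomial, fussCatalanNumber]
  | succ k =>
    have h : ∀ (f : ℕ → ℝ), ∏ i ∈ Finset.Icc 1 k, f i = ∏ i ∈ Finset.range k, f (i + 1) := by
      intro f
      rw [Finset.range_eq_Ico, Finset.prod_Ico_add' f 0 k 1]
      rfl
    have hpr : ∀ i ∈ Finset.range k, ((k + 1 : ℕ) : ℝ) * p + p - ((i + 1 : ℕ) : ℝ)
        = (((k + 1 : ℕ) : ℝ) + 1) * p - ((i + 1 : ℕ) : ℝ) := fun i _ => by ring
    rw [generalizedBinomial_eq_prod, fussCatalanNumber, h, Finset.prod_congr rfl hpr,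
      Finset.prod_range_succ']
    have h2 : (((k + 1 : ℕ) : ℝ) + 1) ≠ 0 := by positivity
    have h3 : ((k + 1).factorial : ℝ) ≠ 0 := by positivity
    rw [Nat.cast_zero, sub_zero]
    field_simp

/-! ### The density, its moments and its unimodality -/

open Classical in
/-- The density of the Fuss-Catalan distribution `μ(p, p)` for `p > 1`. -/
noncomputable def fussCatalanDensity (p x : ℝ) : ℝ :=
  if x ∈ curveValue p '' Ioo 0 (Real.pi / p) then
    curveHeight p (Function.invFunOn (curveValue p) (Ioo 0 (Real.pi / p)) x) / Real.pi else 0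

lemma fussCatalanDensity_curveValue {p φ : ℝ} (hp : 1 < p) (hφ : φ ∈ Ioo 0 (Real.pi / p)) :
    fussCatalanDensity p (curveValue p φ) = curveHeight p φ / Real.pi := by
  rw [fussCatalanDensity, if_pos (mem_image_of_mem _ hφ),
    (strictAntiOn_curveValue hp).injOn.leftInvOn_invFunOn hφ]

lemma fussCatalanDensity_of_notMem {p x : ℝ}
    (hx : x ∉ curveValue p '' Ioo 0 (Real.pi / p)) : fussCatalanDensity p x = 0 :=
  if_neg hx

lemma fussCatalanDensity_nonneg {p : ℝ} (hp : 1 < p) (x : ℝ) : 0 ≤ fussCatalanDensity p x := by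
  by_cases hx : x ∈ curveValue p '' Ioo 0 (Real.pi / p)
  · obtain ⟨φ, hφ, rfl⟩ := hx
    rw [fussCatalanDensity_curveValue hp hφ]
    exact div_nonneg (curveHeight_pos hp hφ).le Real.pi_pos.le
  · exact (fussCatalanDensity_of_notMem hx).ge

lemma fussCatalanDensity_moment {p : ℝ} (hp : 1 < p) (k : ℕ) :
    Integrable (fun x => fussCatalanDensity p x * x ^ k) ∧
      ∫ x, fussCatalanDensity p x * x ^ k = fussCatalanNumber p p k := by
  have hd : ∀ φ ∈ Ioo 0 (Real.pi / p), HasDerivWithinAt (curveValue p)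
      (deriv (curveValue p) φ) (Ioo 0 (Real.pi / p)) φ := fun φ hφ => by
    obtain ⟨r, -, hr⟩ := exists_hasDerivAt_curveValue_neg hp hφ
    exact hr.differentiableAt.hasDerivAt.hasDerivWithinAt
  have hinj := (strictAntiOn_curveValue hp).injOn
  have hzero : ∀ x ∉ curveValue p '' Ioo 0 (Real.pi / p), fussCatalanDensity p x * x ^ k = 0 :=
    fun x hx => by rw [fussCatalanDensity_of_notMem hx, zero_mul]
  have heq : EqOn (fun φ => |deriv (curveValue p) φ| •
        (fussCatalanDensity p (curveValue p φ) * curveValue p φ ^ k))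
      (fun φ => |deriv (curveValue p) φ| * (curveValue p φ ^ k * (curveHeight p φ / Real.pi)))
      (Ioo 0 (Real.pi / p)) := fun φ hφ => by
    simp only [fussCatalanDensity_curveValue hp hφ, smul_eq_mul]
    ring
  obtain ⟨h1, h2⟩ := curve_moment hp k
  constructor
  · rw [← integrableOn_iff_integrable_of_support_subset
      (s := curveValue p '' Ioo 0 (Real.pi / p)) fun x hx => by_contra fun h => hx (hzero x h)]
    rw [integrableOn_image_iff_integrableOn_abs_deriv_smul measurableSet_Ioo hd hinj]
    exact h1.congr_fun heq.symm measurableSet_Ioo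
  · rw [← setIntegral_eq_integral_of_forall_compl_eq_zero hzero,
      integral_image_eq_integral_abs_deriv_smul measurableSet_Ioo hd hinj,
      setIntegral_congr_fun measurableSet_Ioo heq, h2,
      generalizedBinomial_div_eq_fussCatalanNumber]

lemma integrable_fussCatalanDensity {p : ℝ} (hp : 1 < p) : Integrable (fussCatalanDensity p) := by
  simpa using (fussCatalanDensity_moment hp 0).1

/-- The Fuss-Catalan distribution `μ(p, p)` for `p > 1`. -/
noncomputable def fussCatalanMeasure (p : ℝ) : Measure ℝ :=
  volume.withDensity fun x => ENNReal.ofReal (fussCatalanDensity p x)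

lemma isFussCatalan_fussCatalanMeasure {p : ℝ} (hp : 1 < p) :
    IsFussCatalan p p (fussCatalanMeasure p) := by
  have hmeas : AEMeasurable (fun x => ENNReal.ofReal (fussCatalanDensity p x)) :=
    (integrable_fussCatalanDensity hp).aemeasurable.ennreal_ofReal
  have htop : ∀ᵐ x : ℝ, ENNReal.ofReal (fussCatalanDensity p x) < ⊤ := by simp
  have hreal : ∀ x, (ENNReal.ofReal (fussCatalanDensity p x)).toReal = fussCatalanDensity p x :=
    fun x => ENNReal.toReal_ofReal (fussCatalanDensity_nonneg hp x)
  refine ⟨⟨?_⟩, fun k => ?_, fun k => ?_⟩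
  · rw [fussCatalanMeasure, withDensity_apply _ MeasurableSet.univ, Measure.restrict_univ,
      ← ofReal_integral_eq_lintegral_ofReal (integrable_fussCatalanDensity hp)
        (ae_of_all _ (fussCatalanDensity_nonneg hp))]
    have := (fussCatalanDensity_moment hp 0).2
    simp only [pow_zero, mul_one] at this
    rw [this]
    simp [fussCatalanNumber]
  · rw [fussCatalanMeasure, integrable_withDensity_iff_integrable_smul₀' hmeas htop]
    simp only [hreal, smul_eq_mul]
    exact (fussCatalanDensity_moment hp k).1
  · rw [fussCatalanMeasure, integral_withDensity_eq_integral_toReal_smul₀ hmeas htop]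
    simp only [hreal, smul_eq_mul]
    exact (fussCatalanDensity_moment hp k).2

/-- The density has mass `1` and vanishes off values of `ρ`, all of which lie between `0` and `M`.
-/
lemma fussCatalanNumber_even_le {p : ℝ} (hp : 1 < p) (k : ℕ) :
    fussCatalanNumber p p (2 * k) ≤ ((p / (p - 1)) ^ p / (1 / (p - 1))) ^ (2 * k) := by
  set M := (p / (p - 1)) ^ p / (1 / (p - 1))
  have h1 : ∫ x, fussCatalanDensity p x = 1 := by
    have := (fussCatalanDensity_moment hp 0).2
    simpa [fussCatalanNumber] using this
  calc fussCatalanNumber p p (2 * k) = ∫ x, fussCatalanDensity p x * x ^ (2 * k) :=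
        (fussCatalanDensity_moment hp _).2.symm
    _ ≤ ∫ x, fussCatalanDensity p x * M ^ (2 * k) := by
        refine integral_mono (fussCatalanDensity_moment hp _).1
          ((integrable_fussCatalanDensity hp).mul_const _) fun x => ?_
        by_cases hx : x ∈ curveValue p '' Ioo 0 (Real.pi / p)
        · obtain ⟨φ, hφ, rfl⟩ := hx
          exact mul_le_mul_of_nonneg_left
            (pow_le_pow_left₀ (curveValue_pos hp hφ).le (curveValue_le hp hφ) _)
            (fussCatalanDensity_nonneg hp _)
        · simp [fussCatalanDensity_of_notMem hx]
    _ = M ^ (2 * k) := by rw [integral_mul_const, h1, one_mul]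

/-- The mode is the value of `ρ` at the peak of the height, and there is no atom. As `ρ` reverses
order, points left of the mode come from parameters beyond the peak. The image of `ρ` is an
interval, so the extension by zero keeps both monotonicities. -/
lemma isUnimodal_fussCatalanMeasure {p : ℝ} (hp : 1 < p) : IsUnimodal (fussCatalanMeasure p) := by
  obtain ⟨c, hc, hmono, hanti⟩ := exists_curveHeight_mode hp
  have hρ := strictAntiOn_curveValue hp
  have hconn : OrdConnected (curveValue p '' Ioo 0 (Real.pi / p)) := by
    refine (isPreconnected_Ioo.image _ fun φ hφ => ?_).ordConnected
    obtain ⟨r, -, hr⟩ := exists_hasDerivAt_curveValue_neg hp hφ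
    exact hr.continuousAt.continuousWithinAt
  have hcS := mem_image_of_mem (curveValue p) hc
  refine ⟨curveValue p c, 0, fussCatalanDensity p, fussCatalanDensity_nonneg hp, ?_, ?_, ?_⟩
  · intro x hx y hy hxy
    by_cases hxS : x ∈ curveValue p '' Ioo 0 (Real.pi / p)
    · have hyS := hconn.out hxS hcS ⟨hxy, (mem_Iio.1 hy).le⟩
      obtain ⟨φ, hφ, rfl⟩ := hxS
      obtain ⟨ψ, hψ, rfl⟩ := hyS
      rw [fussCatalanDensity_curveValue hp hφ, fussCatalanDensity_curveValue hp hψ]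
      have h1 := (hρ.lt_iff_gt hφ hc).1 hx
      have h2 := (hρ.lt_iff_gt hψ hc).1 hy
      have h3 := (hρ.le_iff_ge hφ hψ).1 hxy
      exact div_le_div_of_nonneg_right (hanti ⟨h2.le, hψ.2⟩ ⟨h1.le, hφ.2⟩ h3) Real.pi_pos.le
    · rw [fussCatalanDensity_of_notMem hxS]
      exact fussCatalanDensity_nonneg hp y
  · intro x hx y hy hxy
    by_cases hyS : y ∈ curveValue p '' Ioo 0 (Real.pi / p)
    · have hxS := hconn.out hcS hyS ⟨(mem_Ioi.1 hx).le, hxy⟩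
      obtain ⟨φ, hφ, rfl⟩ := hxS
      obtain ⟨ψ, hψ, rfl⟩ := hyS
      rw [fussCatalanDensity_curveValue hp hφ, fussCatalanDensity_curveValue hp hψ]
      have h1 := (hρ.lt_iff_gt hc hφ).1 hx
      have h2 := (hρ.lt_iff_gt hc hψ).1 hy
      have h3 := (hρ.le_iff_ge hφ hψ).1 hxy
      exact div_le_div_of_nonneg_right (hmono ⟨hψ.1, h2.le⟩ ⟨hφ.1, h1.le⟩ h3) Real.pi_pos.le
    · rw [fussCatalanDensity_of_notMem hyS]
      exact fussCatalanDensity_nonneg hp x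
  · rw [zero_smul, zero_add, fussCatalanMeasure]

/-! ### Uniqueness, the case `p = 1`, and the conclusion -/

lemma IsFussCatalan.eq_of_even_le {p r M : ℝ} {μ ν : Measure ℝ} (hμ : IsFussCatalan p r μ)
    (hν : IsFussCatalan p r ν) (hM : ∀ k : ℕ, fussCatalanNumber p r (2 * k) ≤ M ^ (2 * k)) :
    μ = ν := by
  have := hμ.isProbabilityMeasure
  have := hν.isProbabilityMeasure
  refine measure_ext_of_moments (M := M) hμ.integrable_pow hν.integrable_pow
    (fun k => by rw [hμ.integral_pow, hν.integral_pow]) fun k => ?_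
  rw [hμ.integral_pow]
  exact hM k

lemma fussCatalanNumber_one_one (k : ℕ) : fussCatalanNumber 1 1 k = 1 := by
  rw [← generalizedBinomial_div_eq_fussCatalanNumber]
  -- For `p = 1` the binomial is `binom(k+1, k) = k + 1`.
  suffices h : ∀ k : ℕ, generalizedBinomial k ((k + 1) * 1) = k + 1 by
    rw [h, div_self (by positivity)]
  intro k
  induction k with
  | zero => simp [generalizedBinomial]
  | succ k ih =>
    rw [generalizedBinomial]
    have e : (((k + 1 : ℕ) : ℝ) + 1) * 1 - 1 = (k + 1) * 1 := by push_cast; ring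
    rw [e, ih]
    push_cast
    field_simp

lemma isFussCatalan_dirac_one : IsFussCatalan 1 1 (Measure.dirac 1) where
  isProbabilityMeasure := inferInstance
  integrable_pow k := integrable_dirac (by simp)
  integral_pow k := by rw [integral_dirac, one_pow, fussCatalanNumber_one_one]

lemma isUnimodal_dirac (a : ℝ) : IsUnimodal (Measure.dirac a) :=
  ⟨a, 1, fun _ => 0, fun _ => le_rfl, monotoneOn_const, antitoneOn_const, by simp⟩

theorem mainTheorem6 (p : ℝ) (hp : 1 ≤ p) :
    (∃! μ : Measure ℝ, IsFussCatalan p p μ) ∧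
      ∀ μ : Measure ℝ, IsFussCatalan p p μ → IsUnimodal μ := by
  -- One unimodal solution with geometrically bounded even moments suffices: every other solution
  -- equals it.
  obtain ⟨μ, M, hμ, huni, hM⟩ : ∃ (μ : Measure ℝ) (M : ℝ), IsFussCatalan p p μ ∧ IsUnimodal μ ∧
      ∀ k : ℕ, fussCatalanNumber p p (2 * k) ≤ M ^ (2 * k) := by
    rcases hp.eq_or_lt with rfl | hp
    · exact ⟨_, 1, isFussCatalan_dirac_one, isUnimodal_dirac 1, fun k => by
        rw [fussCatalanNumber_one_one, one_pow]⟩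
    · exact ⟨_, _, isFussCatalan_fussCatalanMeasure hp, isUnimodal_fussCatalanMeasure hp,
        fussCatalanNumber_even_le hp⟩
  exact ⟨⟨μ, hμ, fun ν hν => hν.eq_of_even_le hμ hM⟩, fun ν hν => hν.eq_of_even_le hμ hM ▸ huni⟩
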